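/- Let $p,q\in[0,1]$, $0<r\le\tfrac12$ and $\lambda>0$. Consider the controlled Markov chain with states $$s_k=\frac{1}{2r}\Big[1+(1-2r)^{k+1}-2(1-r)^{k+1}\Big],\qquad k=0,1,2,\dots,$$ actions $d\in\{0,1\}$ (idle / jam), one-step reward $s-\lambda d$, and transitions from $s_k$ to $s_0$ with probability $p$ and to $s_{k+1}$ with probability $1-p$ if $d=0$, and to $s_0$ with probability $p(1-q)$ and to $s_{k+1}$ with probability $1-p(1-q)$ if $d=1$. A causal policy $\phi$ chooses $d(t)$, possibly at random, from $s(0),d(0),\dots,s(t-1),d(t-1),s(t)$; its average reward from $s(0)$ is $\liminf_{T\to\infty}\frac1T\,\mathbb E^{\phi}\big[\sum_{t=0}^{T-1}(s(t)-\lambda d(t))\,\big|\,s(0)\big]$. Then the Bellman optimality equation $$\theta+V(s)=\max_{d\in\{0,1\}}\Big\{s-\lambda d+\sum_{s'}\Pr(s\to s'\mid d)\,V(s')\Big\}\quad\text{for all states } s$$ has a solution $(\theta,V)$ with $V$ bounded. For every such solution, $\theta$ is the maximum over all causal policies of the average reward, for every initial state; there is a stationary policy that in each state prescribes an action attaining the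 maximum in the Bellman equation; and every such stationary policy attains the average reward $\theta$ from every initial state and is an increasing threshold policy: either there is an $n\in\mathbb N$ such that it prescribes $d=0$ in every state $s_k<s_n$ and $d=1$ in every state $s_k\ge s_n$, or it prescribes $d=0$ in every state (infinite threshold). -/

import Mathlib

open Filter

noncomputable section

namespace EAoII

/-- The value `s_k = (1/2r) [1 + (1-2r)^(k+1) - 2 (1-r)^(k+1)]` of the expected age of incorrect
information when `k` slots have passed since the last successful reception.  For `0 < r ≤ 1/2`
the map `k ↦ s_k` is injective, so the state `s_k` is represented below by its index `k`. -/
def eaoii (r : ℝ) (k : ℕ) : ℝ :=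
  1 / (2 * r) * (1 + (1 - 2 * r) ^ (k + 1) - 2 * (1 - r) ^ (k + 1))

/-- The law on `Bool` with mass `x` at `true` and `1 - x` at `false`. -/
def coin (x : unitInterval) : PMF Bool :=
  PMF.ofFintype
    (fun b => if b then (unitInterval.toNNReal x : ENNReal)
      else (unitInterval.toNNReal (unitInterval.symm x) : ENNReal))
    (by
      rw [Fintype.sum_bool]
      simp only [if_true, Bool.false_eq_true, if_false]
      exact_mod_cast unitInterval.toNNReal_add_toNNReal_symm x)

/-- The probability that the packet is received: `p` if the adversary is idle (`d = false`), and
`p (1 - q)` if it jams (`d = true`). -/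
def receptionProb (p q : unitInterval) (d : Bool) : unitInterval :=
  if d then p * unitInterval.symm q else p

/-- The law of the next state from `s_k` under the action `d`: `s_0` if the packet is received,
and `s_{k+1}` otherwise. -/
def transition (p q : unitInterval) (k : ℕ) (d : Bool) : PMF ℕ :=
  (coin (receptionProb p q d)).map fun received => if received then 0 else k + 1

/-- The expectation of `f` under the discrete law `μ`. -/
def expect {α : Type} (μ : PMF α) (f : α → ℝ) : ℝ :=
  ∑' a, (μ a).toReal * f a

/-- The one-step reward `s_k - lam * d`. -/
def reward (r lam : ℝ) (k : ℕ) (d : Bool) : ℝ :=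
  eaoii r k - lam * (if d then 1 else 0)

/-- What the adversary has observed when it chooses `d(t)`: the list of the past pairs
`(s(0), d(0)), …, (s(t-1), d(t-1))`, and the current state `s(t)`. -/
abbrev History : Type := List (ℕ × Bool) × ℕ

/-- A causal jamming policy: a (possibly randomized) choice of the action from the history. -/
abbrev Policy : Type := History → PMF Bool

/-- The stationary deterministic policy that plays `d k` in state `s_k`. -/
def stationary (d : ℕ → Bool) : Policy := fun h => PMF.pure (d h.2)

/-- The law of the history at time `t` under the policy `φ` with `s(0) = s_k`. -/
def historyLaw (p q : unitInterval) (φ : Policy) (k : ℕ) : ℕ → PMF History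
  | 0 => PMF.pure ([], k)
  | t + 1 => (historyLaw p q φ k t).bind fun h =>
      (φ h).bind fun d =>
        (transition p q h.2 d).map fun j => (h.1 ++ [(h.2, d)], j)

/-- The joint law of the state and the action `(s(t), d(t))` under `φ` with `s(0) = s_k`. -/
def stateActionLaw (p q : unitInterval) (φ : Policy) (k t : ℕ) : PMF (ℕ × Bool) :=
  (historyLaw p q φ k t).bind fun h => (φ h).map fun d => (h.2, d)

/-- The expected reward `E^φ[R(t) | s(0) = s_k]`. -/
def expectedReward (p q : unitInterval) (r lam : ℝ) (φ : Policy) (k t : ℕ) : ℝ :=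
  expect (stateActionLaw p q φ k t) fun x => reward r lam x.1 x.2

/-- The long-term average reward
`liminf_{T → ∞} (1/T) E^φ[∑_{t < T} R(t) | s(0) = s_k]`. -/
def averageReward (p q : unitInterval) (r lam : ℝ) (φ : Policy) (k : ℕ) : ℝ :=
  liminf (fun T : ℕ => 1 / (T : ℝ) * ∑ t ∈ Finset.range T, expectedReward p q r lam φ k t) atTop

/-- The quantity maximized in the Bellman equation at state `s_k`:
`s_k - lam * d + ∑_{s'} Pr(s_k → s' | d) V(s')`. -/
def actionValue (p q : unitInterval) (r lam : ℝ) (V : ℕ → ℝ) (k : ℕ) (d : Bool) : ℝ :=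
  reward r lam k d + expect (transition p q k d) V

/-- `(θ, V)` solves the average-reward Bellman optimality equation, with a bounded differential
reward-to-go function `V` (`V k` stands for `V(s_k)`). -/
def IsBellmanSolution (p q : unitInterval) (r lam θ : ℝ) (V : ℕ → ℝ) : Prop :=
  (∃ C : ℝ, ∀ k, |V k| ≤ C) ∧
    ∀ k, θ + V k = max (actionValue p q r lam V k false) (actionValue p q r lam V k true)

/-- The decision rule `d` prescribes in every state an action that attains the maximum in the
Bellman equation. -/
def AttainsMax (p q : unitInterval) (r lam : ℝ) (V : ℕ → ℝ) (d : ℕ → Bool) : Prop :=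
  ∀ k a, actionValue p q r lam V k a ≤ actionValue p q r lam V k (d k)

/-- `d` is an increasing threshold policy: for some finite threshold `s_n` it is idle in the states
`s_k < s_n` and jams in the states `s_k ≥ s_n`; or the threshold is infinite and it never jams. -/
def IsIncreasingThreshold (r : ℝ) (d : ℕ → Bool) : Prop :=
  (∃ n : ℕ, ∀ k, (eaoii r k < eaoii r n → d k = false) ∧ (eaoii r n ≤ eaoii r k → d k = true)) ∨
    ∀ k, d k = false

end EAoII

end

/-! Optimality is a telescoping argument. If `(θ, V)` solves the Bellman equation, every policy
satisfies E[R(t)] ≤ θ + E[V(s(t))] - E[V(s(t+1))], with equality for a stationary policy that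
attains the maximum. Summing and dividing by T leaves θ plus a term of order 1/T, because `V` is
bounded.

The threshold form comes from monotonicity. Jamming at `s_k` gains p q (V(k+1) - V(0)) - lam over
idling, which increases with k once `V` does. That `V` is strictly increasing
(`IsBellmanSolution.strictMono`) follows from boundedness: `continuation` is monotone and
1-Lipschitz in the successor's value, so one nonpositive increment would make `V` fall at least
linearly.

Existence is by vanishing discount. The increments in k of the discounted values lie between 0 and
`eaoiiGap r k`, whatever the discount. These gaps are dominated by a geometric sequence, so the
values relative to `s_0` lie in a compact product, and a subsequence converges as the discount tends
to 1. -/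

open scoped Topology

noncomputable section

namespace EAoII

/-! ### Expectations of bounded functions under discrete laws -/

section Expect

variable {α β : Type}

theorem summable_toReal (μ : PMF α) : Summable fun a => (μ a).toReal :=
  ENNReal.summable_toReal μ.tsum_coe_ne_top

theorem tsum_toReal (μ : PMF α) : ∑' a, (μ a).toReal = 1 := by
  rw [← ENNReal.tsum_toReal_eq μ.apply_ne_top, μ.tsum_coe, ENNReal.toReal_one]

theorem summable_expect (μ : PMF α) {f : α → ℝ} {C : ℝ} (hf : ∀ a, |f a| ≤ C) :
    Summable fun a => (μ a).toReal * f a := by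
  refine Summable.of_norm_bounded ((summable_toReal μ).mul_right C) fun a => ?_
  rw [Real.norm_eq_abs, abs_mul, abs_of_nonneg ENNReal.toReal_nonneg]
  exact mul_le_mul_of_nonneg_left (hf a) ENNReal.toReal_nonneg

theorem expect_const (μ : PMF α) (c : ℝ) : expect μ (fun _ => c) = c := by
  rw [expect, tsum_mul_right, tsum_toReal, one_mul]

theorem expect_mono (μ : PMF α) {f g : α → ℝ} {C D : ℝ} (hf : ∀ a, |f a| ≤ C)
    (hg : ∀ a, |g a| ≤ D) (h : ∀ a, f a ≤ g a) : expect μ f ≤ expect μ g :=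
  (summable_expect μ hf).tsum_le_tsum
    (fun a => mul_le_mul_of_nonneg_left (h a) ENNReal.toReal_nonneg) (summable_expect μ hg)

theorem abs_expect_le (μ : PMF α) {f : α → ℝ} {C : ℝ} (hf : ∀ a, |f a| ≤ C) :
    |expect μ f| ≤ C := by
  have hC : ∀ _ : α, |C| ≤ |C| := fun _ => le_rfl
  have hC' : ∀ _ : α, |-C| ≤ |C| := fun _ => (abs_neg C).le
  rw [abs_le]
  constructor
  · simpa only [expect_const] using expect_mono μ hC' hf fun a => (abs_le.1 (hf a)).1
  · simpa only [expect_const] using expect_mono μ hf hC fun a => (abs_le.1 (hf a)).2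

theorem expect_add (μ : PMF α) {f g : α → ℝ} {C D : ℝ} (hf : ∀ a, |f a| ≤ C)
    (hg : ∀ a, |g a| ≤ D) : expect μ (fun a => f a + g a) = expect μ f + expect μ g := by
  simp only [expect, mul_add]
  exact (summable_expect μ hf).tsum_add (summable_expect μ hg)

theorem expect_pure (a : α) (f : α → ℝ) : expect (PMF.pure a) f = f a := by
  rw [expect, tsum_eq_single a]
  · simp
  · intro b hb
    simp [PMF.pure_apply, hb]

/-- Fubini: the joint weights have total mass one, so a bounded `f` makes the double series
absolutely summable and the sums can be exchanged. -/
theorem expect_bind (μ : PMF α) (κ : α → PMF β) {f : β → ℝ} {C : ℝ} (hf : ∀ b, |f b| ≤ C) :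
    expect (μ.bind κ) f = expect μ fun a => expect (κ a) f := by
  have hsum : Summable fun x : α × β => (μ x.1).toReal * (κ x.1 x.2).toReal := by
    rw [summable_prod_of_nonneg fun x => mul_nonneg ENNReal.toReal_nonneg ENNReal.toReal_nonneg]
    refine ⟨fun a => (summable_toReal (κ a)).mul_left (μ a).toReal, ?_⟩
    refine (summable_toReal μ).congr fun a => ?_
    exact (by rw [tsum_mul_left, tsum_toReal, mul_one] :
      (μ a).toReal = ∑' b, (μ a).toReal * (κ a b).toReal)
  have hsum' : Summable (Function.uncurry fun (a : α) (b : β) =>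
      (μ a).toReal * (κ a b).toReal * f b) := by
    refine Summable.of_norm_bounded (hsum.mul_right C) fun x => ?_
    rw [Function.uncurry, Real.norm_eq_abs, abs_mul,
      abs_of_nonneg (mul_nonneg ENNReal.toReal_nonneg ENNReal.toReal_nonneg)]
    exact mul_le_mul_of_nonneg_left (hf _)
      (mul_nonneg ENNReal.toReal_nonneg ENNReal.toReal_nonneg)
  have hcoe : ∀ b, ((μ.bind κ) b).toReal = ∑' a, (μ a).toReal * (κ a b).toReal := by
    intro b
    rw [PMF.bind_apply, ENNReal.tsum_toReal_eq fun a =>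
      ENNReal.mul_ne_top (μ.apply_ne_top a) ((κ a).apply_ne_top b)]
    simp only [ENNReal.toReal_mul]
  calc expect (μ.bind κ) f = ∑' b, ∑' a, (μ a).toReal * (κ a b).toReal * f b := by
        rw [expect]
        exact tsum_congr fun b => by rw [hcoe, tsum_mul_right]
    _ = ∑' a, ∑' b, (μ a).toReal * (κ a b).toReal * f b := hsum'.tsum_comm
    _ = expect μ fun a => expect (κ a) f := by
        rw [expect]
        exact tsum_congr fun a => by rw [expect, ← tsum_mul_left]; simp only [mul_assoc]

theorem expect_map (μ : PMF α) (g : α → β) {f : β → ℝ} {C : ℝ} (hf : ∀ b, |f b| ≤ C) :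
    expect (μ.map g) f = expect μ fun a => f (g a) := by
  rw [← PMF.bind_pure_comp, expect_bind μ _ hf]
  simp only [Function.comp, expect_pure]

end Expect

/-! ### One-step formulas and estimates for the states -/

section Model

variable {p q : unitInterval} {r lam θ : ℝ} {V : ℕ → ℝ}

theorem expect_coin (x : unitInterval) (f : Bool → ℝ) :
    expect (coin x) f = x * f true + (1 - x) * f false := by
  simp [expect, coin, tsum_fintype]

theorem expect_transition (hV : ∃ C : ℝ, ∀ k, |V k| ≤ C) (k : ℕ) (d : Bool) :
    expect (transition p q k d) V =
      receptionProb p q d * V 0 + (1 - receptionProb p q d) * V (k + 1) := by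
  obtain ⟨C, hC⟩ := hV
  rw [transition, expect_map _ _ hC, expect_coin]
  simp

theorem actionValue_false (hV : ∃ C : ℝ, ∀ k, |V k| ≤ C) (k : ℕ) :
    actionValue p q r lam V k false = eaoii r k + (p * V 0 + (1 - p) * V (k + 1)) := by
  simp [actionValue, reward, expect_transition hV, receptionProb]

theorem actionValue_true (hV : ∃ C : ℝ, ∀ k, |V k| ≤ C) (k : ℕ) :
    actionValue p q r lam V k true =
      eaoii r k - lam + (p * (1 - q) * V 0 + (1 - p * (1 - q)) * V (k + 1)) := by
  simp [actionValue, reward, expect_transition hV, receptionProb]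

/-- The distance from `s_k` to the supremum `1 / (2 r)` of the states. -/
def eaoiiGap (r : ℝ) (k : ℕ) : ℝ := 1 / (2 * r) - eaoii r k

theorem eaoii_zero : eaoii r 0 = 0 := by
  rw [eaoii]; ring

theorem eaoii_succ_sub (hr : 0 < r) (k : ℕ) :
    eaoii r (k + 1) - eaoii r k = (1 - r) ^ (k + 1) - (1 - 2 * r) ^ (k + 1) := by
  rw [eaoii, eaoii]; field_simp; ring

theorem eaoii_strictMono (hr : 0 < r) (hr2 : r ≤ 1 / 2) : StrictMono (eaoii r) := by
  refine strictMono_nat_of_lt_succ fun k => ?_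
  have h : (1 - 2 * r) ^ (k + 1) < (1 - r) ^ (k + 1) :=
    pow_lt_pow_left₀ (by linarith) (by linarith) k.succ_ne_zero
  linarith [eaoii_succ_sub hr k]

theorem eaoii_nonneg (hr : 0 < r) (hr2 : r ≤ 1 / 2) (k : ℕ) : 0 ≤ eaoii r k := by
  rw [← eaoii_zero (r := r)]
  exact (eaoii_strictMono hr hr2).monotone k.zero_le

theorem eaoiiGap_eq (k : ℕ) :
    eaoiiGap r k = 1 / (2 * r) * (2 * (1 - r) ^ (k + 1) - (1 - 2 * r) ^ (k + 1)) := by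
  rw [eaoiiGap, eaoii]; ring

theorem eaoiiGap_nonneg (hr : 0 < r) (hr2 : r ≤ 1 / 2) (k : ℕ) : 0 ≤ eaoiiGap r k := by
  have h : (1 - 2 * r) ^ (k + 1) ≤ (1 - r) ^ (k + 1) :=
    pow_le_pow_left₀ (by linarith) (by linarith) _
  have h' : 0 ≤ (1 - r) ^ (k + 1) := pow_nonneg (by linarith) _
  rw [eaoiiGap_eq]
  exact mul_nonneg (by positivity) (by linarith)

theorem eaoiiGap_le (hr : 0 < r) (hr2 : r ≤ 1 / 2) (k : ℕ) :
    eaoiiGap r k ≤ 1 / r * (1 - r) ^ k := by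
  have h : 0 ≤ (1 - 2 * r) ^ (k + 1) := pow_nonneg (by linarith) _
  have h' : 0 ≤ (1 - r) ^ k := pow_nonneg (by linarith) _
  have e : 1 / r * (1 - r) ^ k = 1 / (2 * r) * (2 * (1 - r) ^ k) := by field_simp
  rw [eaoiiGap_eq, e]
  refine mul_le_mul_of_nonneg_left ?_ (by positivity)
  rw [pow_succ (1 - r)]
  nlinarith

theorem eaoii_le (hr : 0 < r) (hr2 : r ≤ 1 / 2) (k : ℕ) : eaoii r k ≤ 1 / (2 * r) := by
  have := eaoiiGap_nonneg hr hr2 k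
  rw [eaoiiGap] at this
  linarith

theorem abs_reward_le (hr : 0 < r) (hr2 : r ≤ 1 / 2) (hlam : 0 < lam) (k : ℕ) (d : Bool) :
    |reward r lam k d| ≤ 1 / (2 * r) + lam := by
  have h₀ := eaoii_nonneg hr hr2 k
  have h₁ := eaoii_le hr hr2 k
  rw [reward, abs_le]
  cases d <;> simp <;> constructor <;> simp at h₁ <;> linarith

/-! ### Verification -/

/-- The expectation of `V(s(t))` under the policy `φ` with `s(0) = s_k`. -/
def expectedPotential (p q : unitInterval) (V : ℕ → ℝ) (φ : Policy) (k t : ℕ) : ℝ :=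
  expect (historyLaw p q φ k t) fun h => V h.2

/-- The Markov property: even for a history-dependent policy, the next state depends on the past
only through the current state and action. -/
theorem expectedPotential_succ (hV : ∃ C : ℝ, ∀ k, |V k| ≤ C) (φ : Policy) (k t : ℕ) :
    expectedPotential p q V φ k (t + 1) =
      expect (stateActionLaw p q φ k t) fun x => expect (transition p q x.1 x.2) V := by
  obtain ⟨C, hC⟩ := hV
  have hE : ∀ x : ℕ × Bool, |expect (transition p q x.1 x.2) V| ≤ C := fun x => abs_expect_le _ hC
  rw [expectedPotential, historyLaw, expect_bind _ _ fun h : History => hC h.2, stateActionLaw,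
    expect_bind _ _ hE]
  congr 1
  ext h
  rw [expect_bind _ _ fun h : History => hC h.2, expect_map _ _ hE]
  congr 1
  ext d
  exact expect_map _ _ fun h : History => hC h.2

theorem expectedReward_add_potential (hr : 0 < r) (hr2 : r ≤ 1 / 2) (hlam : 0 < lam)
    (hV : ∃ C : ℝ, ∀ k, |V k| ≤ C) (φ : Policy) (k t : ℕ) :
    expectedReward p q r lam φ k t + expectedPotential p q V φ k (t + 1) =
      expect (stateActionLaw p q φ k t) fun x => actionValue p q r lam V x.1 x.2 := by
  rw [expectedPotential_succ hV]
  obtain ⟨C, hC⟩ := hV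
  exact (expect_add _ (fun x : ℕ × Bool => abs_reward_le hr hr2 hlam x.1 x.2)
    fun x : ℕ × Bool => abs_expect_le _ hC).symm

theorem exists_abs_actionValue_le (hr : 0 < r) (hr2 : r ≤ 1 / 2) (hlam : 0 < lam)
    (hV : ∃ C : ℝ, ∀ k, |V k| ≤ C) : ∃ D, ∀ k d, |actionValue p q r lam V k d| ≤ D := by
  obtain ⟨C, hC⟩ := hV
  exact ⟨_, fun k d => (abs_add_le _ _).trans
    (add_le_add (abs_reward_le hr hr2 hlam k d) (abs_expect_le _ hC))⟩

theorem expect_stateActionLaw_fst (hV : ∃ C : ℝ, ∀ k, |V k| ≤ C) (φ : Policy) (k t : ℕ) :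
    expect (stateActionLaw p q φ k t) (fun x => V x.1) = expectedPotential p q V φ k t := by
  obtain ⟨C, hC⟩ := hV
  rw [stateActionLaw, expect_bind _ _ fun x : ℕ × Bool => hC x.1, expectedPotential]
  congr 1
  ext h
  rw [expect_map _ _ fun x : ℕ × Bool => hC x.1]
  exact expect_const (φ h) (V h.2)

theorem expect_stateActionLaw_const_add (hV : ∃ C : ℝ, ∀ k, |V k| ≤ C) (φ : Policy) (k t : ℕ) :
    expect (stateActionLaw p q φ k t) (fun x => θ + V x.1) =
      θ + expectedPotential p q V φ k t := by
  rw [← expect_stateActionLaw_fst hV]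
  obtain ⟨C, hC⟩ := hV
  rw [expect_add _ (fun _ => le_refl |θ|) (fun x : ℕ × Bool => hC x.1), expect_const]

theorem IsBellmanSolution.actionValue_le (h : IsBellmanSolution p q r lam θ V) (k : ℕ)
    (d : Bool) : actionValue p q r lam V k d ≤ θ + V k := by
  rw [h.2 k]
  cases d
  exacts [le_max_left _ _, le_max_right _ _]

theorem IsBellmanSolution.actionValue_eq (h : IsBellmanSolution p q r lam θ V) {d : ℕ → Bool}
    (hd : AttainsMax p q r lam V d) (k : ℕ) : actionValue p q r lam V k (d k) = θ + V k :=
  le_antisymm (h.actionValue_le k _) (h.2 k ▸ max_le (hd k _) (hd k _))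

theorem IsBellmanSolution.expectedReward_le (hr : 0 < r) (hr2 : r ≤ 1 / 2) (hlam : 0 < lam)
    (h : IsBellmanSolution p q r lam θ V) (φ : Policy) (k t : ℕ) :
    expectedReward p q r lam φ k t ≤
      θ + (expectedPotential p q V φ k t - expectedPotential p q V φ k (t + 1)) := by
  obtain ⟨D, hD⟩ := exists_abs_actionValue_le (p := p) (q := q) hr hr2 hlam h.1
  obtain ⟨C, hC⟩ := h.1
  have hle := expect_mono (stateActionLaw p q φ k t) (fun x => hD x.1 x.2)
    (fun x => (abs_add_le θ (V x.1)).trans (add_le_add_right (hC x.1) _))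
    (fun x => h.actionValue_le x.1 x.2)
  rw [← expectedReward_add_potential hr hr2 hlam h.1, expect_stateActionLaw_const_add h.1] at hle
  linarith

theorem expect_stateActionLaw_stationary (d : ℕ → Bool) {f : ℕ × Bool → ℝ} {C : ℝ}
    (hf : ∀ x, |f x| ≤ C) (k t : ℕ) :
    expect (stateActionLaw p q (stationary d) k t) f =
      expect (historyLaw p q (stationary d) k t) fun h => f (h.2, d h.2) := by
  rw [stateActionLaw, expect_bind _ _ hf]
  congr 1
  ext h
  rw [expect_map _ _ hf, stationary, expect_pure]

theorem IsBellmanSolution.expectedReward_eq (hr : 0 < r) (hr2 : r ≤ 1 / 2) (hlam : 0 < lam)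
    (h : IsBellmanSolution p q r lam θ V) {d : ℕ → Bool} (hd : AttainsMax p q r lam V d)
    (k t : ℕ) :
    expectedReward p q r lam (stationary d) k t =
      θ + (expectedPotential p q V (stationary d) k t -
        expectedPotential p q V (stationary d) k (t + 1)) := by
  obtain ⟨D, hD⟩ := exists_abs_actionValue_le (p := p) (q := q) hr hr2 hlam h.1
  obtain ⟨C, hC⟩ := h.1
  have e := expectedReward_add_potential (p := p) (q := q) hr hr2 hlam h.1 (stationary d) k t
  rw [expect_stateActionLaw_stationary d (fun x => hD x.1 x.2)] at e
  simp only [h.actionValue_eq hd] at e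
  rw [expect_add _ (fun _ => le_refl |θ|) (fun x : History => hC x.2), expect_const] at e
  change _ + _ = θ + expectedPotential p q V (stationary d) k t at e
  linarith

theorem abs_expectedPotential_le {C : ℝ} (hC : ∀ k, |V k| ≤ C) (φ : Policy) (k t : ℕ) :
    |expectedPotential p q V φ k t| ≤ C :=
  abs_expect_le _ fun h => hC h.2

theorem sum_const_add_sub (θ : ℝ) (P : ℕ → ℝ) (T : ℕ) :
    ∑ t ∈ Finset.range T, (θ + (P t - P (t + 1))) = T * θ + (P 0 - P T) := by
  rw [Finset.sum_add_distrib, Finset.sum_range_sub', Finset.sum_const, Finset.card_range,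
    nsmul_eq_mul]

theorem tendsto_average_const_add_sub (θ : ℝ) {P : ℕ → ℝ} {C : ℝ} (hP : ∀ t, |P t| ≤ C) :
    Tendsto (fun T : ℕ => 1 / (T : ℝ) * ∑ t ∈ Finset.range T, (θ + (P t - P (t + 1)))) atTop
      (𝓝 θ) := by
  have hz : Tendsto (fun T : ℕ => 1 / (T : ℝ) * (P 0 - P T)) atTop (𝓝 0) := by
    refine squeeze_zero_norm (a := fun T : ℕ => 1 / (T : ℝ) * (C + C)) (fun T => ?_) ?_
    · rw [norm_mul, Real.norm_eq_abs, Real.norm_eq_abs, abs_of_nonneg (by positivity)]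
      exact mul_le_mul_of_nonneg_left ((abs_sub _ _).trans (add_le_add (hP 0) (hP T)))
        (by positivity)
    · simpa using tendsto_one_div_atTop_nhds_zero_nat.mul_const (C + C)
  have hs := hz.const_add θ
  rw [add_zero] at hs
  refine hs.congr' ?_
  filter_upwards [eventually_gt_atTop 0] with T hT
  have hT' : (T : ℝ) ≠ 0 := by positivity
  rw [sum_const_add_sub]
  field_simp

theorem IsBellmanSolution.averageReward_eq (hr : 0 < r) (hr2 : r ≤ 1 / 2) (hlam : 0 < lam)
    (h : IsBellmanSolution p q r lam θ V) {d : ℕ → Bool} (hd : AttainsMax p q r lam V d)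
    (k : ℕ) : averageReward p q r lam (stationary d) k = θ := by
  obtain ⟨C, hC⟩ := h.1
  simp only [averageReward, h.expectedReward_eq hr hr2 hlam hd]
  exact (tendsto_average_const_add_sub θ fun t =>
    abs_expectedPotential_le hC (stationary d) k t).liminf_eq

theorem abs_expectedReward_le (hr : 0 < r) (hr2 : r ≤ 1 / 2) (hlam : 0 < lam) (φ : Policy)
    (k t : ℕ) : |expectedReward p q r lam φ k t| ≤ 1 / (2 * r) + lam :=
  abs_expect_le _ fun x => abs_reward_le hr hr2 hlam x.1 x.2

theorem IsBellmanSolution.averageReward_le (hr : 0 < r) (hr2 : r ≤ 1 / 2) (hlam : 0 < lam)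
    (h : IsBellmanSolution p q r lam θ V) (φ : Policy) (k : ℕ) :
    averageReward p q r lam φ k ≤ θ := by
  obtain ⟨C, hC⟩ := h.1
  have ht := tendsto_average_const_add_sub θ fun t =>
    abs_expectedPotential_le (p := p) (q := q) hC φ k t
  rw [averageReward, ← ht.liminf_eq]
  refine liminf_le_liminf (Eventually.of_forall fun T => ?_) ?_ ht.isBoundedUnder_le.isCoboundedUnder_ge
  · exact mul_le_mul_of_nonneg_left
      (Finset.sum_le_sum fun t _ => h.expectedReward_le hr hr2 hlam φ k t) (by positivity)
  -- Comparing real liminfs requires the smaller sequence to be bounded below; the uniform bound on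
  -- rewards supplies this.
  · refine isBoundedUnder_of_eventually_ge (a := -(1 / (2 * r) + lam)) ?_
    filter_upwards [eventually_gt_atTop 0] with T hT
    have hT' : (0 : ℝ) < T := by positivity
    have hs : (Finset.range T).card • (-(1 / (2 * r) + lam)) ≤
        ∑ t ∈ Finset.range T, expectedReward p q r lam φ k t :=
      Finset.card_nsmul_le_sum _ _ _ fun t _ =>
        (abs_le.1 (abs_expectedReward_le hr hr2 hlam φ k t)).1
    rw [Finset.card_range, nsmul_eq_mul] at hs
    rw [one_div_mul_eq_div, le_div_iff₀ hT']
    linarith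

/-! ### Monotonicity of the differential reward and the threshold structure -/

/-- The largest value over the two actions of the discounted continuation, minus the jamming cost,
when `a` and `b` are the probabilities of reception if idle and if jamming, `v` is the value of
`s_0`, and `x` the value of the state that follows a loss. -/
def continuation (a b lam β v x : ℝ) : ℝ :=
  max (β * (a * v + (1 - a) * x)) (-lam + β * (b * v + (1 - b) * x))

section Continuation

variable {a b β v w x y : ℝ}

theorem continuation_mono (ha : a ∈ unitInterval) (hb : b ∈ unitInterval) (hβ : 0 ≤ β)
    (hvw : v ≤ w) (hxy : x ≤ y) :
    continuation a b lam β v x ≤ continuation a b lam β w y := by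
  have key : ∀ c ∈ unitInterval, β * (c * v + (1 - c) * x) ≤ β * (c * w + (1 - c) * y) :=
    fun c hc => mul_le_mul_of_nonneg_left (add_le_add (mul_le_mul_of_nonneg_left hvw hc.1)
      (mul_le_mul_of_nonneg_left hxy (sub_nonneg.2 hc.2))) hβ
  exact max_le_max (key a ha) (add_le_add_right (key b hb) _)

/-- Each branch is affine in the successor's value with slope β (1 - c) ≤ 1, and a maximum inherits
the bound. -/
theorem continuation_sub_le (ha : a ∈ unitInterval) (hb : b ∈ unitInterval)
    (hβ : β ∈ unitInterval) (hxy : x ≤ y) :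
    continuation a b lam β v y - continuation a b lam β v x ≤ y - x := by
  have key : ∀ c ∈ unitInterval,
      β * (c * v + (1 - c) * y) ≤ β * (c * v + (1 - c) * x) + (y - x) := by
    intro c hc
    have h₁ : β * (1 - c) ≤ 1 := mul_le_one₀ hβ.2 (sub_nonneg.2 hc.2) (by linarith [hc.1])
    nlinarith [mul_le_mul_of_nonneg_right h₁ (sub_nonneg.2 hxy)]
  rw [sub_le_iff_le_add', continuation, continuation, max_add]
  exact max_le_max (key a ha) (by linarith [key b hb])

/-- The transition weights sum to one. This is what permits normalizing the discounted values at
`s_0`. -/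
theorem continuation_add (c : ℝ) :
    continuation a b lam β (v + c) (x + c) = continuation a b lam β v x + β * c := by
  rw [continuation, continuation, max_add]
  congr 1 <;> ring

theorem continuous_continuation (a b lam : ℝ) :
    Continuous fun z : ℝ × ℝ × ℝ => continuation a b lam z.1 z.2.1 z.2.2 := by
  unfold continuation
  fun_prop

end Continuation

theorem isBellmanSolution_iff : IsBellmanSolution p q r lam θ V ↔ (∃ C : ℝ, ∀ k, |V k| ≤ C) ∧
    ∀ k, θ + V k = eaoii r k + continuation p (p * (1 - q)) lam 1 (V 0) (V (k + 1)) := by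
  refine and_congr_right fun hV => forall_congr' fun k => ?_
  rw [actionValue_false hV, actionValue_true hV, continuation, one_mul, one_mul, add_max,
    ← add_assoc (eaoii r k) (-lam), ← sub_eq_add_neg]

theorem receptionProb_jam_mem (p q : unitInterval) : (p * (1 - q) : ℝ) ∈ unitInterval :=
  (p * unitInterval.symm q).2

/-- Subtract the Bellman equations at k and k + 1. A nonnegative next increment would force a
positive current one, by monotonicity of `continuation`; hence the next increment is negative, and
the Lipschitz bound applies. -/
theorem IsBellmanSolution.sub_le (hr : 0 < r) (hr2 : r ≤ 1 / 2)
    (h : IsBellmanSolution p q r lam θ V) {k : ℕ} (hk : V (k + 1) ≤ V k) :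
    V (k + 2) - V (k + 1) ≤ V (k + 1) - V k - (eaoii r (k + 1) - eaoii r k) := by
  have hs := eaoii_strictMono hr hr2 k.lt_succ_self
  have h₀ := (isBellmanSolution_iff.1 h).2 k
  have h₁ := (isBellmanSolution_iff.1 h).2 (k + 1)
  have hb := receptionProb_jam_mem p q
  rcases le_total (V (k + 1)) (V (k + 2)) with hle | hle
  · have := continuation_mono (lam := lam) p.2 hb zero_le_one (le_refl (V 0)) hle
    simp only [Nat.succ_eq_add_one] at *
    linarith
  · have := continuation_sub_le (lam := lam) (v := V 0) p.2 hb ⟨zero_le_one, le_rfl⟩ hle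
    linarith

theorem IsBellmanSolution.strictMono (hr : 0 < r) (hr2 : r ≤ 1 / 2)
    (h : IsBellmanSolution p q r lam θ V) : StrictMono V := by
  refine strictMono_nat_of_lt_succ fun k => ?_
  by_contra! hk
  have hs := eaoii_strictMono hr hr2 k.lt_succ_self
  rw [Nat.succ_eq_add_one] at hs
  set δ := eaoii r (k + 1) - eaoii r k with hδ
  -- The later gaps of `eaoii` shrink to zero, but the first gap `δ` already bounds all subsequent
  -- increments away from zero.
  have hdec : ∀ n, V (k + n + 2) - V (k + n + 1) ≤ -δ := by
    intro n
    induction n with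
    | zero => have := h.sub_le hr hr2 hk; simp only [add_zero]; linarith
    | succ n ih =>
      have hn : V (k + n + 1 + 1) ≤ V (k + n + 1) := by
        have : V (k + n + 1 + 1) = V (k + n + 2) := rfl
        linarith
      have h₁ := h.sub_le hr hr2 hn
      have h₂ := eaoii_strictMono hr hr2 (k + n + 1).lt_succ_self
      have h₃ : V (k + (n + 1) + 2) - V (k + (n + 1) + 1) =
        V (k + n + 1 + 2) - V (k + n + 1 + 1) := by ring_nf
      have h₄ : V (k + n + 1 + 1) = V (k + n + 2) := rfl
      rw [Nat.succ_eq_add_one] at h₂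
      linarith
  have hsum : ∀ n : ℕ, V (k + n + 1) ≤ V (k + 1) - n * δ := by
    intro n
    induction n with
    | zero => simp
    | succ n ih =>
      have h₁ : V (k + (n + 1) + 1) = V (k + n + 2) := by ring_nf
      have h₂ := hdec n
      push_cast
      linarith
  obtain ⟨C, hC⟩ := h.1
  obtain ⟨n, hn⟩ := exists_nat_gt ((V (k + 1) + C) / δ)
  rw [div_lt_iff₀ (by linarith)] at hn
  linarith [hsum n, (abs_le.1 (hC (k + n + 1))).1]

theorem IsBellmanSolution.isIncreasingThreshold (hr : 0 < r) (hr2 : r ≤ 1 / 2) (hlam : 0 < lam)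
    (h : IsBellmanSolution p q r lam θ V) {d : ℕ → Bool} (hd : AttainsMax p q r lam V d) :
    IsIncreasingThreshold r d := by
  by_cases hex : ∃ n, d n = true
  · classical
    have hfind := Nat.find_spec hex
    have hmin := fun m => @Nat.find_min _ _ hex m
    set n := Nat.find hex
    refine Or.inl ⟨n, fun k => ⟨fun hk => ?_, fun hk => ?_⟩⟩
    · simpa using hmin k ((eaoii_strictMono hr hr2).lt_iff_lt.1 hk)
    · rcases ((eaoii_strictMono hr hr2).le_iff_le.1 hk).eq_or_lt with rfl | hlt
      · exact hfind
      · by_contra hdk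
        have hn := hd n false
        have hk' := hd k true
        rw [hfind, actionValue_false h.1, actionValue_true h.1] at hn
        rw [Bool.eq_false_iff.2 hdk, actionValue_false h.1, actionValue_true h.1] at hk'
        have hpq : (0 : ℝ) ≤ p * q := mul_nonneg p.2.1 q.2.1
        have hV := h.strictMono hr hr2 (Nat.succ_lt_succ hlt)
        -- Choosing to jam at `n` means p q (V(n+1) - V(0)) ≥ lam > 0, which excludes p q = 0. The
        -- gain is then strictly larger at `k`, so ties cannot break the threshold.
        have hpos : (0 : ℝ) < p * q := by
          refine hpq.lt_of_ne fun h0 => ?_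
          have : (p : ℝ) * q * (V (n + 1) - V 0) = 0 := by rw [← h0, zero_mul]
          linarith
        have := mul_lt_mul_of_pos_left hV hpos
        simp only [Nat.succ_eq_add_one] at this
        linarith
  · exact Or.inr fun k => by simpa using fun hk => hex ⟨k, hk⟩

theorem exists_attainsMax (p q : unitInterval) (r lam : ℝ) (V : ℕ → ℝ) :
    ∃ d : ℕ → Bool, AttainsMax p q r lam V d := by
  have (k : ℕ) : ∃ d : Bool, ∀ a, actionValue p q r lam V k a ≤ actionValue p q r lam V k d :=
    Finite.exists_max _
  choose d hd using this
  exact ⟨d, hd⟩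

/-! ### Existence of a solution by vanishing discount -/

/-- The value function of the `β`-discounted problem with `n` decisions to go. -/
def discountedValue (a b r lam β : ℝ) : ℕ → ℕ → ℝ
  | 0, _ => 0
  | n + 1, k => eaoii r k +
      continuation a b lam β (discountedValue a b r lam β n 0) (discountedValue a b r lam β n (k + 1))

section Discounted

variable {a b β : ℝ}

theorem discountedValue_le_succ (hr : 0 < r) (hr2 : r ≤ 1 / 2) (ha : a ∈ unitInterval)
    (hb : b ∈ unitInterval) (hβ : 0 ≤ β) (n k : ℕ) :
    discountedValue a b r lam β n k ≤ discountedValue a b r lam β (n + 1) k := by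
  induction n generalizing k with
  | zero =>
    have h : (0 : ℝ) ≤ continuation a b lam β 0 0 := le_max_of_le_left (by simp)
    simpa [discountedValue] using add_nonneg (eaoii_nonneg hr hr2 k) h
  | succ n ih =>
    rw [discountedValue, discountedValue]
    exact add_le_add_right (continuation_mono ha hb hβ (ih 0) (ih (k + 1))) _

theorem discountedValue_nonneg (hr : 0 < r) (hr2 : r ≤ 1 / 2) (ha : a ∈ unitInterval)
    (hb : b ∈ unitInterval) (hβ : 0 ≤ β) (n k : ℕ) : 0 ≤ discountedValue a b r lam β n k :=
  monotone_nat_of_le_succ (f := fun n => discountedValue a b r lam β n k)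
    (fun m => discountedValue_le_succ hr hr2 ha hb hβ m k) n.zero_le

theorem discountedValue_le (hr : 0 < r) (hr2 : r ≤ 1 / 2) (hlam : 0 < lam) (ha : a ∈ unitInterval)
    (hb : b ∈ unitInterval) (hβ : 0 ≤ β) (hβ1 : β < 1) (n k : ℕ) :
    discountedValue a b r lam β n k ≤ 1 / (2 * r) / (1 - β) := by
  have h1β : 0 < 1 - β := by linarith
  induction n generalizing k with
  | zero => rw [discountedValue]; positivity
  | succ n ih =>
    set B := 1 / (2 * r) / (1 - β) with hB
    have hcont : continuation a b lam β B B ≤ β * B := by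
      refine max_le (le_of_eq (by ring)) ?_
      have : b * B + (1 - b) * B = B := by ring
      rw [this]; linarith
    have h₁ := continuation_mono (lam := lam) ha hb hβ (ih 0) (ih (k + 1))
    have h₂ : (1 - β) * B = 1 / (2 * r) := by rw [hB]; field_simp
    rw [discountedValue]
    linarith [eaoii_le hr hr2 k]

/-- The upper bound reproduces itself under one Bellman step: (s_{k+1} - s_k) + `eaoiiGap r (k + 1)`
equals `eaoiiGap r k`. It involves neither `β` nor `n`. -/
theorem discountedValue_succ_sub_mem (hr : 0 < r) (hr2 : r ≤ 1 / 2) (ha : a ∈ unitInterval)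
    (hb : b ∈ unitInterval) (hβ : β ∈ unitInterval) (n k : ℕ) :
    discountedValue a b r lam β n (k + 1) - discountedValue a b r lam β n k ∈
      Set.Icc 0 (eaoiiGap r k) := by
  induction n generalizing k with
  | zero => simpa [discountedValue] using eaoiiGap_nonneg hr hr2 k
  | succ n ih =>
    obtain ⟨h₁, h₂⟩ := ih (k + 1)
    have hle := sub_nonneg.1 h₁
    have h₃ := continuation_mono (lam := lam) ha hb hβ.1
      (le_refl (discountedValue a b r lam β n 0)) hle
    have h₄ := continuation_sub_le (lam := lam) (v := discountedValue a b r lam β n 0) ha hb hβ hle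
    have hs := eaoii_strictMono hr hr2 k.lt_succ_self
    rw [Nat.succ_eq_add_one] at hs
    rw [eaoiiGap] at *
    rw [discountedValue, discountedValue]
    constructor <;> linarith

/-- The discounted problem relative to `s_0`: `θ` is `1 - β` times its value at `s_0`, and `h` the
difference of its value function from that at `s_0`, which is bounded uniformly in `β`. -/
theorem exists_discounted_solution (hr : 0 < r) (hr2 : r ≤ 1 / 2) (hlam : 0 < lam)
    (ha : a ∈ unitInterval) (hb : b ∈ unitInterval) (hβ : 0 ≤ β) (hβ1 : β < 1) :
    ∃ (θ : ℝ) (h : ℕ → ℝ), θ ∈ Set.Icc 0 (1 / (2 * r)) ∧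
      (∀ k, h k ∈ Set.Icc 0 (1 / r ^ 2)) ∧ h 0 = 0 ∧
      ∀ k, θ + h k = eaoii r k + continuation a b lam β 0 (h (k + 1)) := by
  have h1β : 0 < 1 - β := by linarith
  have hlim : ∀ k, ∃ w, Tendsto (fun n => discountedValue a b r lam β n k) atTop (𝓝 w) := by
    intro k
    refine ⟨_, tendsto_atTop_ciSup
      (monotone_nat_of_le_succ fun m => discountedValue_le_succ hr hr2 ha hb hβ m k) ?_⟩
    exact ⟨_, Set.forall_mem_range.2 fun n => discountedValue_le hr hr2 hlam ha hb hβ hβ1 n k⟩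
  choose W hW using hlim
  have hfix : ∀ k, W k = eaoii r k + continuation a b lam β (W 0) (W (k + 1)) := by
    intro k
    refine tendsto_nhds_unique ((tendsto_add_atTop_iff_nat 1).2 (hW k)) ?_
    exact tendsto_const_nhds.add (((continuous_continuation a b lam).tendsto (β, W 0, W (k + 1))).comp
      (tendsto_const_nhds.prodMk_nhds ((hW 0).prodMk_nhds (hW (k + 1)))))
  have hstep : ∀ k, W (k + 1) - W k ∈ Set.Icc 0 (eaoiiGap r k) := fun k =>
    isClosed_Icc.mem_of_tendsto ((hW (k + 1)).sub (hW k))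
      (Eventually.of_forall fun n => discountedValue_succ_sub_mem hr hr2 ha hb ⟨hβ, hβ1.le⟩ n k)
  have hW0 : W 0 ∈ Set.Icc 0 (1 / (2 * r) / (1 - β)) :=
    isClosed_Icc.mem_of_tendsto (hW 0) (Eventually.of_forall fun n =>
      ⟨discountedValue_nonneg hr hr2 ha hb hβ n 0,
        discountedValue_le hr hr2 hlam ha hb hβ hβ1 n 0⟩)
  have hmono : Monotone W := monotone_nat_of_le_succ fun k => sub_nonneg.1 (hstep k).1
  -- The right side is the partial geometric sum of (1 / r) (1 - r)^j over j < k, from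
  -- `eaoiiGap_le`.
  have hup : ∀ k, W k - W 0 ≤ 1 / r ^ 2 * (1 - (1 - r) ^ k) := by
    intro k
    induction k with
    | zero => simp
    | succ k ih =>
      have e : 1 / r ^ 2 * (1 - (1 - r) ^ (k + 1)) =
          1 / r ^ 2 * (1 - (1 - r) ^ k) + 1 / r * (1 - r) ^ k := by
        field_simp; ring
      linarith [(hstep k).2, eaoiiGap_le hr hr2 k]
  refine ⟨(1 - β) * W 0, fun k => W k - W 0, ⟨mul_nonneg h1β.le hW0.1, ?_⟩, fun k => ⟨?_, ?_⟩,
    sub_self _, fun k => ?_⟩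
  · rw [mul_comm]; exact (le_div_iff₀ h1β).1 hW0.2
  · exact sub_nonneg.2 (hmono k.zero_le)
  · refine (hup k).trans (mul_le_of_le_one_right (by positivity) ?_)
    linarith [pow_nonneg (by linarith : (0 : ℝ) ≤ 1 - r) k]
  · have e := continuation_add (a := a) (b := b) (lam := lam) (β := β) (v := 0)
      (x := W (k + 1) - W 0) (W 0)
    rw [zero_add, sub_add_cancel] at e
    have := hfix k
    rw [e] at this
    linarith

end Discounted

theorem exists_isBellmanSolution (p q : unitInterval) (hr : 0 < r) (hr2 : r ≤ 1 / 2)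
    (hlam : 0 < lam) : ∃ (θ : ℝ) (V : ℕ → ℝ), IsBellmanSolution p q r lam θ V := by
  have hex (n : ℕ) := exists_discounted_solution (β := 1 - 1 / ((n : ℝ) + 1)) hr hr2 hlam p.2
    (receptionProb_jam_mem p q)
    (sub_nonneg.2 (by rw [div_le_one (by positivity)]; linarith [n.cast_nonneg (α := ℝ)]))
    (sub_lt_self _ (by positivity))
  choose θ h hθ hh hh0 heq using hex
  -- Tychonoff; the product is countable, so compactness yields a convergent subsequence,
  -- simultaneously for the gains and for all coordinates.
  have hK : IsCompact (Set.Icc (0 : ℝ) (1 / (2 * r)) ×ˢ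
      Set.univ.pi fun _ : ℕ => Set.Icc (0 : ℝ) (1 / r ^ 2)) :=
    isCompact_Icc.prod (isCompact_univ_pi fun _ => isCompact_Icc)
  obtain ⟨⟨θ', V⟩, hmem, φ, hφ, hlim⟩ := hK.tendsto_subseq (x := fun n => (θ n, h n))
    fun n => ⟨hθ n, fun k _ => hh n k⟩
  have hθ' : Tendsto (fun n => θ (φ n)) atTop (𝓝 θ') := (continuous_fst.tendsto _).comp hlim
  have hV (k : ℕ) : Tendsto (fun n => h (φ n) k) atTop (𝓝 (V k)) :=
    (((continuous_apply k).comp continuous_snd).tendsto _).comp hlim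
  have hβ : Tendsto (fun n => 1 - 1 / ((φ n : ℝ) + 1)) atTop (𝓝 1) := by
    simpa using (tendsto_one_div_add_atTop_nhds_zero_nat.comp hφ.tendsto_atTop).const_sub (1 : ℝ)
  have hV0 : V 0 = 0 := tendsto_nhds_unique (hV 0) (by simp [hh0])
  refine ⟨θ', V, isBellmanSolution_iff.2 ⟨⟨1 / r ^ 2, fun k => ?_⟩, fun k => ?_⟩⟩
  · have := hmem.2 k trivial
    exact abs_le.2 ⟨by linarith [this.1, this.2], this.2⟩
  · rw [hV0]
    refine tendsto_nhds_unique (hθ'.add (hV k)) ?_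
    simp only [heq]
    exact tendsto_const_nhds.add (((continuous_continuation _ _ lam).tendsto (1, 0, V (k + 1))).comp
      (hβ.prodMk_nhds (tendsto_const_nhds.prodMk_nhds (hV (k + 1)))))

end Model

end EAoII

end

theorem theorem1 (p q : unitInterval) (r lam : ℝ) (hr : 0 < r) (hr2 : r ≤ 1 / 2)
    (hlam : 0 < lam) :
    (∃ (θ : ℝ) (V : ℕ → ℝ), EAoII.IsBellmanSolution p q r lam θ V) ∧
    ∀ (θ : ℝ) (V : ℕ → ℝ), EAoII.IsBellmanSolution p q r lam θ V →
      (∀ k : ℕ, IsGreatest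
        (Set.range fun φ : EAoII.Policy => EAoII.averageReward p q r lam φ k) θ) ∧
      (∃ d : ℕ → Bool, EAoII.AttainsMax p q r lam V d) ∧
      ∀ d : ℕ → Bool, EAoII.AttainsMax p q r lam V d →
        EAoII.IsIncreasingThreshold r d ∧
        ∀ k : ℕ, EAoII.averageReward p q r lam (EAoII.stationary d) k = θ := by
  refine ⟨EAoII.exists_isBellmanSolution p q hr hr2 hlam, fun θ V h => ?_⟩
  obtain ⟨d₀, hd₀⟩ := EAoII.exists_attainsMax p q r lam V
  refine ⟨fun k => ⟨⟨EAoII.stationary d₀, h.averageReward_eq hr hr2 hlam hd₀ k⟩, ?_⟩,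
    ⟨d₀, hd₀⟩, fun d hd => ⟨h.isIncreasingThreshold hr hr2 hlam hd,
      fun k => h.averageReward_eq hr hr2 hlam hd k⟩⟩
  exact Set.forall_mem_range.2 fun φ => h.averageReward_le hr hr2 hlam φ k
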